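/- For a finite simple graph $G$ with vertex set $V$, $|V|=n$, let $\mathcal P_G\subset\mathbb R^V\cong\mathbb R^n$ be its symmetric edge polytope, i.e. the convex hull of $\{\pm(\mathbf e_i-\mathbf e_j) : \{i,j\}\in E(G)\}$, where $\mathbf e_i$ is the $i$-th unit coordinate vector, and let $N(\mathcal P_G)$ be the number of facets of $\mathcal P_G$. The $1$-sum of two graphs with exactly one common vertex is their union; the $1$-sum of several graphs is defined by a sequence of such $1$-sums. Equality of graphs below means isomorphism. The Braun–Bruegge conjecture asserts the following for every connected graph $G$ with $n\ge 3$ vertices. (1) If $n$ is odd, then $3\cdot 2^{\frac{n-1}{2}}-2\le N(\mathcal P_G)\le 6^{\frac{n-1}{2}}$. Moreover $N(\mathcal P_G)=3\cdot 2^{\frac{n-1}{2}}-2$ if and only if $G=K_{(n-1)/2,(n+1)/2}$, and $N(\mathcal P_G)=6^{\frac{n-1}{2}}$ if and only if $G$ is a $1$-sum of $(n-1)/2$ triangles. (2) If $n$ is even, then $2^{\frac n2+1}-2\le N(\mathcal P_G)\le 14\cdot 6^{\frac n2-2}$. Moreover $N(\mathcal P_G)=2^{\frac n2+1}-2$ if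 and only if $G=K_{n/2,n/2}$, and $N(\mathcal P_G)=14\cdot 6^{\frac n2-2}$ if and only if $G$ is a $1$-sum of $K_4$ with $n/2-2$ triangles. Proposition. The assertions (1) and (2) hold for every connected graph $G$ with $n$ vertices when $n=3$ or $n=4$. -/

import Mathlib

/-- The symmetric edge polytope of a graph `G` with vertex set `V`: the convex hull in `ℝ^V` of the
vectors `± (e_i - e_j)` for the edges `{i, j}` of `G`. -/
def symmetricEdgePolytope {V : Type*} [DecidableEq V] (G : SimpleGraph V) : Set (V → ℝ) :=
  convexHull ℝ {x | ∃ i j : V, G.Adj i j ∧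
    (x = Pi.single i 1 - Pi.single j 1 ∨ x = -(Pi.single i 1 - Pi.single j 1))}

/-- The dimension of a (nonempty) set in a real vector space: the dimension of its affine hull. -/
noncomputable def affineDim {E : Type*} [AddCommGroup E] [Module ℝ E] (S : Set E) : ℕ :=
  Module.finrank ℝ (vectorSpan ℝ S)

/-- A facet of a polytope `P`: a nonempty face (the set of maximizers on `P` of a linear functional)
of dimension `dim P - 1`. -/
def IsFacet {V : Type*} [Fintype V] (P F : Set (V → ℝ)) : Prop :=
  IsExposed ℝ P F ∧ F.Nonempty ∧ affineDim F + 1 = affineDim P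

/-- The number `N(P)` of facets of a polytope `P`. -/
noncomputable def numFacets {V : Type*} [Fintype V] (P : Set (V → ℝ)) : ℕ :=
  {F : Set (V → ℝ) | IsFacet P F}.ncard

/-- `IsOneSum M H` says that the subgraph `H` of `G` is the `1`-sum of the subgraphs in the multiset
`M`: it is obtained from one of them by adjoining the others one after the other, each having exactly
one vertex in common with the union of those before it. -/
inductive IsOneSum {V : Type*} {G : SimpleGraph V} : Multiset G.Subgraph → G.Subgraph → Prop
  | single (A : G.Subgraph) : IsOneSum {A} A
  | cons (A H : G.Subgraph) (M : Multiset G.Subgraph) (hM : IsOneSum M H)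
      (hv : ∃ v : V, H.verts ∩ A.verts = {v}) : IsOneSum (A ::ₘ M) (H ⊔ A)

/-- `G` is the `1`-sum of `k` triangles. -/
def IsOneSumOfTriangles {V : Type*} (G : SimpleGraph V) (k : ℕ) : Prop :=
  ∃ M : Multiset G.Subgraph, M.card = k ∧
    (∀ A ∈ M, Nonempty (A.coe ≃g (⊤ : SimpleGraph (Fin 3)))) ∧ IsOneSum M ⊤

/-- `G` is the `1`-sum of the complete graph `K₄` with `k` triangles. -/
def IsOneSumOfK4WithTriangles {V : Type*} (G : SimpleGraph V) (k : ℕ) : Prop :=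
  ∃ (K : G.Subgraph) (M : Multiset G.Subgraph), M.card = k ∧
    Nonempty (K.coe ≃g (⊤ : SimpleGraph (Fin 4))) ∧
    (∀ A ∈ M, Nonempty (A.coe ≃g (⊤ : SimpleGraph (Fin 3)))) ∧ IsOneSum (K ::ₘ M) ⊤

/-- What the Braun–Bruegge conjecture asserts about a connected graph `G` with `n ≥ 3` vertices.
(No subtraction and no division of natural numbers below is truncated for such `n`.) -/
def SatisfiesBraunBruegge {V : Type*} [Fintype V] [DecidableEq V] (G : SimpleGraph V) (n : ℕ) :
    Prop :=
  (Odd n →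
    3 * 2 ^ ((n - 1) / 2) - 2 ≤ numFacets (symmetricEdgePolytope G) ∧
    numFacets (symmetricEdgePolytope G) ≤ 6 ^ ((n - 1) / 2) ∧
    (numFacets (symmetricEdgePolytope G) = 3 * 2 ^ ((n - 1) / 2) - 2 ↔
      Nonempty (G ≃g completeBipartiteGraph (Fin ((n - 1) / 2)) (Fin ((n + 1) / 2)))) ∧
    (numFacets (symmetricEdgePolytope G) = 6 ^ ((n - 1) / 2) ↔
      IsOneSumOfTriangles G ((n - 1) / 2))) ∧
  (Even n →
    2 ^ (n / 2 + 1) - 2 ≤ numFacets (symmetricEdgePolytope G) ∧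
    numFacets (symmetricEdgePolytope G) ≤ 14 * 6 ^ (n / 2 - 2) ∧
    (numFacets (symmetricEdgePolytope G) = 2 ^ (n / 2 + 1) - 2 ↔
      Nonempty (G ≃g completeBipartiteGraph (Fin (n / 2)) (Fin (n / 2)))) ∧
    (numFacets (symmetricEdgePolytope G) = 14 * 6 ^ (n / 2 - 2) ↔
      IsOneSumOfK4WithTriangles G (n / 2 - 2)))

/-! The polytope lies in the hyperplane of coordinate sum zero and is symmetric about the origin,
which lies on no facet. So each facet is the section of the polytope by `coeffFunctional f x = 1`
for some `f` with `f i - f j ≤ 1` along every edge, and `f` matters only up to an additive constant.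

Such a section is spanned by the vectors of its tight edges, those with `f i - f j = 1`. It is a
facet exactly when these vectors span the hyperplane, that is, when the tight edges connect all
vertices (`finrank_span_edgeVectors_iff`, `affineDim_facetOf_iff`). Connectedness by unit steps
makes `f` integral once `f r = 0`, so facets correspond to integer labelings
(`numFacets_eq_ncard_facetLabelings`). A label differs from the root's by less than the number of
vertices, so the count is a finite computation (`numFacets_eq_labelingCount`).

Up to isomorphism there are two connected graphs on three vertices, with 4 and 6 facets, and six on
four vertices, with 8, 8, 6, 12, 12 and 14. The minimum is attained only by the complete bipartite
graph and the maximum only by the complete graph, which for these sizes is the only 1-sum of the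
required kind. -/

open Module

/-! ### Affine dimension and linear spans of sections of a convex hull. -/

section General

variable {E : Type*} [AddCommGroup E] [Module ℝ E]

theorem vectorSpan_convexHull_eq (A : Set E) : vectorSpan ℝ (convexHull ℝ A) = vectorSpan ℝ A := by
  rw [← direction_affineSpan, affineSpan_convexHull, direction_affineSpan]

theorem vectorSpan_eq_span_of_neg_mem {A : Set E} (hA : ∀ x ∈ A, -x ∈ A) :
    vectorSpan ℝ A = Submodule.span ℝ A := by
  apply le_antisymm
  · rw [vectorSpan_def, Submodule.span_le]
    rintro _ ⟨x, hx, y, hy, rfl⟩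
    exact Submodule.sub_mem _ (Submodule.subset_span hx) (Submodule.subset_span hy)
  · rw [Submodule.span_le]
    intro x hx
    have h := vsub_mem_vectorSpan ℝ hx (hA x hx)
    have h2 : x = (2⁻¹ : ℝ) • (x -ᵥ -x) := by
      rw [vsub_eq_sub, sub_neg_eq_add, ← two_smul ℝ x, smul_smul]
      norm_num
    rw [h2]
    exact Submodule.smul_mem _ _ h

/-- A nonempty set contained in an affine hyperplane that misses the origin spans a linear subspace
whose dimension exceeds the affine dimension by one. -/
theorem affineDim_add_one_eq_finrank_span [FiniteDimensional ℝ E] {F : Set E} (l : E →ₗ[ℝ] ℝ)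
    (hF : F.Nonempty) (hl : ∀ x ∈ F, l x = 1) :
    affineDim F + 1 = finrank ℝ (Submodule.span ℝ F) := by
  obtain ⟨x₀, hx₀⟩ := hF
  have hker : vectorSpan ℝ F ≤ LinearMap.ker l := by
    rw [vectorSpan_def, Submodule.span_le]
    rintro _ ⟨x, hx, y, hy, rfl⟩
    simp [hl x hx, hl y hy]
  have hx₀0 : x₀ ≠ 0 := by
    rintro rfl
    simpa using hl 0 hx₀
  have hsup : Submodule.span ℝ F = vectorSpan ℝ F ⊔ Submodule.span ℝ {x₀} := by
    apply le_antisymm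
    · rw [Submodule.span_le]
      intro x hx
      have : x = (x -ᵥ x₀) + x₀ := by simp
      rw [this]
      exact Submodule.add_mem_sup (vsub_mem_vectorSpan ℝ hx hx₀) (Submodule.mem_span_singleton_self _)
    · refine sup_le ?_ (Submodule.span_mono (by simpa using hx₀))
      rw [vectorSpan_def, Submodule.span_le]
      rintro _ ⟨x, hx, y, hy, rfl⟩
      exact Submodule.sub_mem _ (Submodule.subset_span hx) (Submodule.subset_span hy)
  have hinf : vectorSpan ℝ F ⊓ Submodule.span ℝ {x₀} = ⊥ := by
    rw [eq_bot_iff]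
    rintro x ⟨h1, h2⟩
    obtain ⟨c, rfl⟩ := Submodule.mem_span_singleton.1 h2
    have := hker h1
    rw [LinearMap.mem_ker, map_smul, hl x₀ hx₀] at this
    have hc : c = 0 := by simpa using this
    simp [hc]
  have h := Submodule.finrank_sup_add_finrank_inf_eq (vectorSpan ℝ F) (Submodule.span ℝ {x₀})
  rw [hinf, ← hsup, finrank_span_singleton hx₀0, finrank_bot] at h
  unfold affineDim
  omega

/-- The points of a convex hull at which a linear functional bounded by `1` attains the value `1`
lie in the span of the generators with this property. -/
theorem mem_span_of_mem_convexHull {A : Set E} (l : E →ₗ[ℝ] ℝ) (hA : ∀ a ∈ A, l a ≤ 1) {x : E}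
    (hx : x ∈ convexHull ℝ A) : l x ≤ 1 ∧ (l x = 1 → x ∈ Submodule.span ℝ {a ∈ A | l a = 1}) := by
  refine convexHull_min (t := {x | l x ≤ 1 ∧ (l x = 1 → x ∈ Submodule.span ℝ {a ∈ A | l a = 1})})
    (fun a ha => ⟨hA a ha, fun h => Submodule.subset_span ⟨ha, h⟩⟩) ?_ hx
  rintro x ⟨hx1, hx2⟩ y ⟨hy1, hy2⟩ a b ha hb hab
  refine ⟨?_, fun h => ?_⟩
  · simp only [map_add, map_smul, smul_eq_mul]
    nlinarith
  · simp only [map_add, map_smul, smul_eq_mul] at h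
    -- A zero weight says nothing about its point, so that case is split off. With both weights
    -- positive, the value 1 forces both points to be tight.
    rcases ha.eq_or_lt with rfl | ha
    · have hb : b = 1 := by linarith
      subst hb
      simpa using hy2 (by linarith)
    rcases hb.eq_or_lt with rfl | hb
    · have ha : a = 1 := by linarith
      subst ha
      simpa using hx2 (by linarith)
    have hx : l x = 1 := by nlinarith
    have hy : l y = 1 := by nlinarith
    exact Submodule.add_mem _ (Submodule.smul_mem _ _ (hx2 hx)) (Submodule.smul_mem _ _ (hy2 hy))

end General

/-! ### Connectivity of a relation and the rank of its edge vectors. -/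

section CutConnected

/-- A relation is cut-connected if every two-colouring that is constant along it is constant. -/
def CutConnected {V : Type*} (T : V → V → Prop) : Prop :=
  ∀ g : V → Bool, (∀ i j, T i j → g i = g j) → ∀ i j, g i = g j

variable {V : Type*}

/-- Two colours suffice: colour each vertex by whether it takes the value at `j`. -/
theorem CutConnected.const {α : Type*} {T : V → V → Prop} (hT : CutConnected T) (g : V → α)
    (hg : ∀ i j, T i j → g i = g j) (i j : V) : g i = g j := by
  classical
  have h := hT (fun k => decide (g k = g j)) (fun a b hab => by simp [hg a b hab]) i j
  simpa using h

theorem SimpleGraph.Connected.cutConnected {G : SimpleGraph V} (hG : G.Connected) :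
    CutConnected G.Adj := by
  intro g hg i j
  obtain ⟨p⟩ := hG.preconnected i j
  induction p with
  | nil => rfl
  | cons h _ ih => exact (hg _ _ h).trans ih

variable [Fintype V] [DecidableEq V]

/-- The edge vectors `e_i - e_j` of a relation. -/
def edgeVectors (T : V → V → Prop) : Set (V → ℝ) :=
  {x | ∃ i j, T i j ∧ x = Pi.single i 1 - Pi.single j 1}

/-- The linear functional on `ℝ^V` with coefficients `f`. -/
noncomputable def coeffFunctional (f : V → ℝ) : (V → ℝ) →ₗ[ℝ] ℝ :=
  Fintype.linearCombination ℝ f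

theorem coeffFunctional_edge (f : V → ℝ) (i j : V) :
    coeffFunctional f (Pi.single i 1 - Pi.single j 1) = f i - f j := by
  simp [coeffFunctional]

theorem coeffFunctional_apply_single (l : (V → ℝ) →ₗ[ℝ] ℝ) :
    coeffFunctional (fun i => l (Pi.single i 1)) = l := by
  apply LinearMap.pi_ext'
  intro i
  ext
  simp [coeffFunctional]

/-- The edge vectors of a relation span a hyperplane of `ℝ^V` if and only if the relation is
cut-connected. -/
theorem finrank_span_edgeVectors_iff [Nonempty V] (T : V → V → Prop) :
    finrank ℝ (Submodule.span ℝ (edgeVectors T)) + 1 = Fintype.card V ↔ CutConnected T := by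
  set W := Submodule.span ℝ (edgeVectors T) with hW
  have hmem : ∀ f : V → ℝ, coeffFunctional f ∈ W.dualAnnihilator ↔ ∀ i j, T i j → f i = f j := by
    intro f
    rw [Submodule.mem_dualAnnihilator]
    constructor
    · intro h i j hij
      have := h _ (Submodule.subset_span ⟨i, j, hij, rfl⟩)
      rw [coeffFunctional_edge] at this
      linarith
    · intro h w hw
      have : W ≤ LinearMap.ker (coeffFunctional f) := by
        rw [hW, Submodule.span_le]
        rintro _ ⟨i, j, hij, rfl⟩
        rw [SetLike.mem_coe, LinearMap.mem_ker, coeffFunctional_edge, h i j hij, sub_self]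
      exact this hw
  have hdim : finrank ℝ W + finrank ℝ W.dualAnnihilator = Fintype.card V := by
    rw [Subspace.finrank_add_finrank_dualAnnihilator_eq, finrank_fintype_fun_eq_card]
  have hone : coeffFunctional (1 : V → ℝ) ∈ W.dualAnnihilator := (hmem 1).2 fun _ _ _ => rfl
  have hone0 : coeffFunctional (1 : V → ℝ) ≠ 0 := by
    obtain ⟨r⟩ := ‹Nonempty V›
    intro h
    have := LinearMap.congr_fun h (Pi.single r 1)
    simp [coeffFunctional] at this
  -- The annihilator consists of the functions constant along `T` and always contains the all-ones
  -- function. A nonconstant two-colouring would give an indicator independent of it.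
  have key : finrank ℝ W.dualAnnihilator = 1 ↔ CutConnected T := by
    constructor
    · intro h g hg i j
      have hv : (⟨_, hone⟩ : W.dualAnnihilator) ≠ 0 := by simpa using hone0
      obtain ⟨c, hc⟩ := (finrank_eq_one_iff_of_nonzero' (K := ℝ) (V := W.dualAnnihilator) ⟨_, hone⟩ hv).1 h
        ⟨coeffFunctional (fun k => if g k then 1 else 0),
          (hmem _).2 fun a b hab => by rw [hg a b hab]⟩
      have hc' := congrArg Subtype.val hc
      have e := fun k => LinearMap.congr_fun hc' (Pi.single k 1)
      simp only [coeffFunctional, SetLike.mk_smul_mk, LinearMap.smul_apply,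
        Fintype.linearCombination_apply_single, Pi.one_apply, smul_eq_mul, mul_one, one_mul] at e
      have := (e i).symm.trans (e j)
      cases hi : g i <;> cases hj : g j <;> simp_all
    · intro h
      have hv : (⟨_, hone⟩ : W.dualAnnihilator) ≠ 0 := by simpa using hone0
      refine (finrank_eq_one_iff_of_nonzero' (K := ℝ) (V := W.dualAnnihilator) ⟨_, hone⟩ hv).2 ?_
      rintro ⟨l, hl⟩
      obtain ⟨r⟩ := ‹Nonempty V›
      refine ⟨l (Pi.single r 1), Subtype.ext ?_⟩
      rw [← coeffFunctional_apply_single l, hmem] at hl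
      have hc := h.const _ hl
      change l (Pi.single r 1) • coeffFunctional (1 : V → ℝ) = l
      apply LinearMap.pi_ext'
      intro i
      ext
      simpa [coeffFunctional] using hc r i
  rw [← key]
  omega

end CutConnected

/-! ### Facets as normalized integer labelings. -/

section Facets

variable {V : Type*} [Fintype V] [DecidableEq V]

omit [Fintype V] in
theorem symmetricEdgePolytope_eq (G : SimpleGraph V) :
    symmetricEdgePolytope G = convexHull ℝ (edgeVectors G.Adj) := by
  unfold symmetricEdgePolytope edgeVectors
  congr 1
  ext x
  constructor
  · rintro ⟨i, j, h, rfl | rfl⟩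
    · exact ⟨i, j, h, rfl⟩
    · exact ⟨j, i, h.symm, neg_sub _ _⟩
  · rintro ⟨i, j, h, rfl⟩
    exact ⟨i, j, h, Or.inl rfl⟩

omit [Fintype V] in
theorem edgeVectors_neg_mem (G : SimpleGraph V) :
    ∀ x ∈ edgeVectors G.Adj, -x ∈ edgeVectors G.Adj := by
  rintro _ ⟨i, j, h, rfl⟩
  exact ⟨j, i, h.symm, neg_sub _ _⟩

theorem affineDim_symmetricEdgePolytope {G : SimpleGraph V} (hG : G.Connected) :
    affineDim (symmetricEdgePolytope G) + 1 = Fintype.card V := by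
  have := hG.nonempty
  unfold affineDim
  rw [symmetricEdgePolytope_eq, vectorSpan_convexHull_eq,
    vectorSpan_eq_span_of_neg_mem (edgeVectors_neg_mem G), finrank_span_edgeVectors_iff]
  exact hG.cutConnected

/-- The part of the symmetric edge polytope on the hyperplane `∑ f i * x i = 1`. -/
def facetOf (G : SimpleGraph V) (f : V → ℝ) : Set (V → ℝ) :=
  {x ∈ symmetricEdgePolytope G | coeffFunctional f x = 1}

theorem span_facetOf (G : SimpleGraph V) (f : V → ℝ) (hf : ∀ i j, G.Adj i j → f i - f j ≤ 1) :
    Submodule.span ℝ (facetOf G f) =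
      Submodule.span ℝ (edgeVectors fun i j => G.Adj i j ∧ f i - f j = 1) := by
  apply le_antisymm
  · rw [Submodule.span_le]
    rintro x ⟨hx, hx1⟩
    rw [symmetricEdgePolytope_eq] at hx
    refine Submodule.span_mono ?_ ((mem_span_of_mem_convexHull (coeffFunctional f) ?_ hx).2 hx1)
    · rintro _ ⟨⟨i, j, hij, rfl⟩, h⟩
      rw [coeffFunctional_edge] at h
      exact ⟨i, j, ⟨hij, h⟩, rfl⟩
    · rintro _ ⟨i, j, hij, rfl⟩
      rw [coeffFunctional_edge]
      exact hf i j hij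
  · apply Submodule.span_mono
    rintro _ ⟨i, j, ⟨hij, h⟩, rfl⟩
    refine ⟨?_, by rw [coeffFunctional_edge, h]⟩
    rw [symmetricEdgePolytope_eq]
    exact subset_convexHull ℝ _ ⟨i, j, hij, rfl⟩

/-- Among the sections by a supporting hyperplane, the facets are those whose tight edges connect
the graph. -/
theorem affineDim_facetOf_iff {G : SimpleGraph V} (hG : G.Connected) (f : V → ℝ)
    (hf : ∀ i j, G.Adj i j → f i - f j ≤ 1) (hne : (facetOf G f).Nonempty) :
    affineDim (facetOf G f) + 1 = affineDim (symmetricEdgePolytope G) ↔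
      CutConnected fun i j => G.Adj i j ∧ f i - f j = 1 := by
  have := hG.nonempty
  have h1 := affineDim_symmetricEdgePolytope hG
  rw [affineDim_add_one_eq_finrank_span (coeffFunctional f) hne fun x hx => hx.2,
    span_facetOf G f hf, ← finrank_span_edgeVectors_iff]
  omega

theorem isExposed_facetOf {G : SimpleGraph V} (f : V → ℝ)
    (hf : ∀ i j, G.Adj i j → f i - f j ≤ 1) : IsExposed ℝ (symmetricEdgePolytope G) (facetOf G f) := by
  rintro ⟨y, hy⟩
  have hle : ∀ x ∈ symmetricEdgePolytope G, coeffFunctional f x ≤ 1 := by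
    intro x hx
    rw [symmetricEdgePolytope_eq] at hx
    refine (mem_span_of_mem_convexHull (coeffFunctional f) ?_ hx).1
    rintro _ ⟨i, j, hij, rfl⟩
    rw [coeffFunctional_edge]
    exact hf i j hij
  refine ⟨LinearMap.toContinuousLinearMap (coeffFunctional f), ?_⟩
  ext x
  simp only [LinearMap.coe_toContinuousLinearMap']
  constructor
  · rintro ⟨hx, hx1⟩
    exact ⟨hx, fun z hz => by rw [hx1]; exact hle z hz⟩
  · rintro ⟨hx, hx1⟩
    exact ⟨hx, le_antisymm (hle x hx) (hy.2 ▸ hx1 y hy.1)⟩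

/-- The integer labelings, normalized at `r`, that define the facets of the symmetric edge
polytope. -/
def facetLabelings (G : SimpleGraph V) (r : V) : Set (V → ℤ) :=
  {f | f r = 0 ∧ (∀ i j, G.Adj i j → f i - f j ≤ 1) ∧
    CutConnected fun i j => G.Adj i j ∧ f i - f j = 1}

theorem isFacet_of_mem_facetLabelings [Nontrivial V] {G : SimpleGraph V} (hG : G.Connected) {r : V}
    {f : V → ℤ} (hf : f ∈ facetLabelings G r) :
    IsFacet (symmetricEdgePolytope G) (facetOf G fun i => (f i : ℝ)) := by
  obtain ⟨-, h1, h2⟩ := hf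
  have h1' : ∀ i j, G.Adj i j → (f i : ℝ) - f j ≤ 1 := fun i j h => by exact_mod_cast h1 i j h
  -- Without a tight edge, cut-connectedness would make even the identity constant.
  have hne : (facetOf G fun i => (f i : ℝ)).Nonempty := by
    by_contra hne
    obtain ⟨a, b, hab⟩ := exists_pair_ne V
    refine hab (h2.const id ?_ a b)
    rintro i j ⟨hij, h⟩
    refine absurd ⟨Pi.single i 1 - Pi.single j 1, ?_, ?_⟩ hne
    · rw [symmetricEdgePolytope_eq]
      exact subset_convexHull ℝ _ ⟨i, j, hij, rfl⟩
    · rw [coeffFunctional_edge]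
      exact_mod_cast h
  refine ⟨isExposed_facetOf _ h1', hne, (affineDim_facetOf_iff hG _ h1' hne).2 ?_⟩
  convert h2 using 4
  norm_cast

/-- Every facet is the section by a supporting hyperplane `∑ f i * x i = 1`. -/
theorem IsFacet.exists_eq_facetOf {G : SimpleGraph V} {F : Set (V → ℝ)}
    (hF : IsFacet (symmetricEdgePolytope G) F) :
    ∃ f : V → ℝ, (∀ i j, G.Adj i j → f i - f j ≤ 1) ∧ F = facetOf G f := by
  obtain ⟨hexp, hne, hdim⟩ := hF
  obtain ⟨l, hl⟩ := hexp hne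
  obtain ⟨x₀, hx₀⟩ := hne
  have hx₀' := hx₀
  rw [hl] at hx₀'
  obtain ⟨hx₀P, hmax⟩ := hx₀'
  have hedge : ∀ i j, G.Adj i j → l (Pi.single i 1 - Pi.single j 1) ≤ l x₀ := by
    intro i j hij
    apply hmax
    rw [symmetricEdgePolytope_eq]
    exact subset_convexHull ℝ _ ⟨i, j, hij, rfl⟩
  -- Otherwise symmetry forces `l` to vanish on the whole polytope, so `F` is the polytope itself
  -- and has the wrong dimension. Positivity permits rescaling the maximum to 1.
  have hpos : 0 < l x₀ := by
    by_contra hneg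
    rw [not_lt] at hneg
    have hzero : ∀ x ∈ symmetricEdgePolytope G, l x = 0 := by
      intro x hx
      rw [symmetricEdgePolytope_eq] at hx
      refine convexHull_min (t := {x | l x = 0}) ?_ ?_ hx
      · rintro _ ⟨i, j, hij, rfl⟩
        have h1 := hedge i j hij
        have h2 := hedge j i hij.symm
        rw [← neg_sub, map_neg] at h2
        exact le_antisymm (by linarith) (by linarith)
      · exact convex_hyperplane l.toLinearMap.isLinear 0
    have : F = symmetricEdgePolytope G := by
      rw [hl]
      ext x
      exact ⟨fun h => h.1, fun h => ⟨h, fun y hy => by rw [hzero x h, hzero y hy]⟩⟩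
    rw [this] at hdim
    omega
  set f : V → ℝ := fun i => (l x₀)⁻¹ * l (Pi.single i 1) with hf
  have hfl : ∀ x, coeffFunctional f x = (l x₀)⁻¹ * l x := by
    intro x
    have h := LinearMap.congr_fun (coeffFunctional_apply_single ((l x₀)⁻¹ • l.toLinearMap)) x
    simpa [hf] using h
  refine ⟨f, fun i j hij => ?_, ?_⟩
  · rw [← coeffFunctional_edge, hfl, inv_mul_le_iff₀ hpos, mul_one]
    exact hedge i j hij
  · ext x
    have h1 : coeffFunctional f x = 1 ↔ l x = l x₀ := by
      rw [hfl, inv_mul_eq_iff_eq_mul₀ hpos.ne', mul_one]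
    rw [hl]
    simp only [facetOf, Set.mem_ofPred_eq, h1]
    refine and_congr_right fun hx => ⟨fun h => le_antisymm (hmax x hx) (h x₀ hx₀P), fun h => ?_⟩
    rw [h]
    exact hmax

/-- Edge vectors have coordinate sum zero, so constants are invisible on the polytope; this allows
normalization at a root. -/
theorem facetOf_congr (G : SimpleGraph V) (f : V → ℝ) (c : ℝ) :
    facetOf G (fun i => f i - c) = facetOf G f := by
  have h : ∀ x ∈ symmetricEdgePolytope G,
      coeffFunctional (fun i => f i - c) x = coeffFunctional f x := by
    intro x hx
    rw [symmetricEdgePolytope_eq] at hx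
    refine convexHull_min
      (t := {x | (coeffFunctional (fun i => f i - c) - coeffFunctional f) x = 0}) ?_ ?_ hx |> sub_eq_zero.1
    · rintro _ ⟨i, j, hij, rfl⟩
      simp [coeffFunctional_edge]
    · exact convex_hyperplane (coeffFunctional _ - coeffFunctional f).isLinear 0
  ext x
  exact and_congr_right fun hx => by rw [h x hx]

omit [Fintype V] [DecidableEq V] in
/-- A real labeling whose steps along a cut-connected relation are all `1` is integral once it is
normalized. -/
theorem CutConnected.exists_int_labeling {T : V → V → Prop} (hT : CutConnected T) (f : V → ℝ)
    (hf : ∀ i j, T i j → f i - f j = 1) (r : V) : ∃ g : V → ℤ, ∀ i, (g i : ℝ) = f i - f r := by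
  -- Constancy is applied to a `Prop`-valued function: integrality of the difference passes along
  -- steps of size 1, starting at `r`.
  have h := hT.const (fun i => ∃ n : ℤ, (n : ℝ) = f i - f r) (fun i j hij => by
    have := hf i j hij
    refine propext ⟨fun ⟨n, hn⟩ => ⟨n - 1, ?_⟩, fun ⟨n, hn⟩ => ⟨n + 1, ?_⟩⟩ <;>
      push_cast <;> linarith) r
  have h' : ∀ i, ∃ n : ℤ, (n : ℝ) = f i - f r := fun i => (h i).mp ⟨0, by simp⟩
  choose g hg using h'
  exact ⟨g, hg⟩

theorem numFacets_eq_ncard_facetLabelings [Nontrivial V] {G : SimpleGraph V} (hG : G.Connected)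
    (r : V) : numFacets (symmetricEdgePolytope G) = (facetLabelings G r).ncard := by
  have himage : {F | IsFacet (symmetricEdgePolytope G) F} =
      (fun f : V → ℤ => facetOf G fun i => (f i : ℝ)) '' facetLabelings G r := by
    ext F
    constructor
    · intro hF
      obtain ⟨f, hf, rfl⟩ := IsFacet.exists_eq_facetOf hF
      have hT := (affineDim_facetOf_iff hG f hf hF.2.1).1 hF.2.2
      obtain ⟨g, hg⟩ := hT.exists_int_labeling f (fun i j h => h.2) r
      have hsub : ∀ i j, ((g i - g j : ℤ) : ℝ) = f i - f j := fun i j => by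
        push_cast
        rw [hg, hg]
        ring
      refine ⟨g, ⟨?_, fun i j hij => ?_, ?_⟩, ?_⟩
      · have := hg r
        rw [sub_self] at this
        exact_mod_cast this
      · have := hf i j hij
        rw [← hsub] at this
        exact_mod_cast this
      · convert hT using 4
        rw [← hsub]
        norm_cast
      · simp only [hg]
        exact facetOf_congr G f (f r)
    · rintro ⟨f, hf, rfl⟩
      exact isFacet_of_mem_facetLabelings hG hf
  unfold numFacets
  rw [himage, Set.InjOn.ncard_image]
  intro f hf g hg hfg
  -- The vector of an edge tight for `f` lies on the common facet, so the edge is tight for `g` too.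
  -- Thus `f - g` is constant along a connecting set of edges, and it vanishes at `r`.
  have hstep : ∀ i j, (G.Adj i j ∧ f i - f j = 1) → f i - g i = f j - g j := by
    rintro i j ⟨hij, h⟩
    have hmem : (Pi.single i 1 - Pi.single j 1 : V → ℝ) ∈ facetOf G fun i => (f i : ℝ) := by
      refine ⟨?_, ?_⟩
      · rw [symmetricEdgePolytope_eq]
        exact subset_convexHull ℝ _ ⟨i, j, hij, rfl⟩
      · rw [coeffFunctional_edge]
        exact_mod_cast h
    have hfg' : (facetOf G fun i => (f i : ℝ)) = facetOf G fun i => (g i : ℝ) := hfg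
    rw [hfg'] at hmem
    have h2 := hmem.2
    rw [coeffFunctional_edge] at h2
    have h3 : g i - g j = 1 := by exact_mod_cast h2
    omega
  funext i
  have := hf.2.2.const (fun i => f i - g i) hstep i r
  simp only [hf.1, hg.1] at this
  omega

end Facets

/-! ### Reduction to a finite, decidable count. -/

section Counting

variable {n : ℕ}

/-- The decidable form of cut-connectedness for relations on `Fin (n + 1)`. -/
def FinCutConnected (R : Fin (n + 1) → Fin (n + 1) → Bool) : Prop :=
  ∀ g : Fin (n + 1) → Bool, (∀ i j, R i j → g i = g j) → ∀ i, g i = g 0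

instance (R : Fin (n + 1) → Fin (n + 1) → Bool) : Decidable (FinCutConnected R) := by
  unfold FinCutConnected
  infer_instance

/-- The labeling with values in `[0, 2n]` that has the value `n` at `0`. -/
def centeredLabeling (f : Fin n → Fin (2 * n + 1)) : Fin (n + 1) → ℕ :=
  Fin.cons n fun k => (f k : ℕ)

/-- The number of facet-defining labelings of the graph with adjacency matrix `R`. -/
def labelingCount (R : Fin (n + 1) → Fin (n + 1) → Bool) : ℕ :=
  (Finset.univ.filter fun f : Fin n → Fin (2 * n + 1) =>
    (∀ i j, R i j → centeredLabeling f i ≤ centeredLabeling f j + 1) ∧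
      FinCutConnected fun i j =>
        R i j && (centeredLabeling f i == centeredLabeling f j + 1)).card

theorem cutConnected_iff_finCutConnected {V : Type*} (e : V ≃ Fin (n + 1)) (T : V → V → Prop)
    (R : Fin (n + 1) → Fin (n + 1) → Bool) (hR : ∀ u v, R (e u) (e v) ↔ T u v) :
    CutConnected T ↔ FinCutConnected R := by
  constructor
  · intro h g hg i
    have := h (g ∘ e) (fun u v huv => hg _ _ ((hR u v).2 huv)) (e.symm i) (e.symm 0)
    simpa using this
  · intro h g hg i j
    have key : ∀ k, g (e.symm k) = g (e.symm 0) :=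
      h (g ∘ e.symm) fun u v huv => hg _ _ ((hR _ _).1 (by simpa using huv))
    have hi := key (e i)
    have hj := key (e j)
    rw [e.symm_apply_apply] at hi hj
    rw [hi, hj]

theorem SimpleGraph.Walk.sub_le_length {V : Type*} {G : SimpleGraph V} {f : V → ℤ}
    (hf : ∀ i j, G.Adj i j → f i - f j ≤ 1) {u v : V} (p : G.Walk u v) :
    f u - f v ≤ p.length := by
  induction p with
  | nil => simp
  | cons h p ih =>
    have := hf _ _ h
    rw [SimpleGraph.Walk.length_cons]
    push_cast
    linarith

/-- A path has fewer edges than the graph has vertices, and the label drops by at most 1 along each.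
-/
theorem SimpleGraph.Connected.sub_lt_card {V : Type*} [Fintype V] {G : SimpleGraph V}
    (hG : G.Connected) {f : V → ℤ} (hf : ∀ i j, G.Adj i j → f i - f j ≤ 1) (u v : V) :
    f u - f v < Fintype.card V := by
  classical
  obtain ⟨p⟩ := hG.preconnected u v
  have h1 := SimpleGraph.Walk.sub_le_length hf (p.toPath : G.Walk u v)
  have h2 := p.toPath.2.length_lt
  omega

theorem ncard_facetLabelings_eq {V : Type*} [Fintype V] [DecidableEq V] {G : SimpleGraph V}
    (hG : G.Connected) (e : V ≃ Fin (n + 1)) (R : Fin (n + 1) → Fin (n + 1) → Bool)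
    (hR : ∀ u v, R (e u) (e v) ↔ G.Adj u v) :
    (facetLabelings G (e.symm 0)).ncard = labelingCount R := by
  have hcard : Fintype.card V = n + 1 := by simpa using Fintype.card_congr e
  unfold labelingCount
  rw [← Set.ncard_coe_finset]
  set Φ : (Fin n → Fin (2 * n + 1)) → V → ℤ := fun f v => (centeredLabeling f (e v) : ℤ) - n with hΦ
  have hinj : Function.Injective Φ := by
    intro f g hfg
    funext k
    have := congrFun hfg (e.symm k.succ)
    simp only [hΦ, centeredLabeling, Equiv.apply_symm_apply, Fin.cons_succ] at this
    omega
  have hmem : ∀ f, Φ f ∈ facetLabelings G (e.symm 0) ↔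
      (∀ i j, R i j → centeredLabeling f i ≤ centeredLabeling f j + 1) ∧
        FinCutConnected fun i j =>
          R i j && (centeredLabeling f i == centeredLabeling f j + 1) := by
    intro f
    have h0 : Φ f (e.symm 0) = 0 := by simp [hΦ, centeredLabeling]
    have h1 : (∀ u v, G.Adj u v → Φ f u - Φ f v ≤ 1) ↔
        ∀ i j, R i j → centeredLabeling f i ≤ centeredLabeling f j + 1 := by
      constructor
      · intro h i j hij
        have := h (e.symm i) (e.symm j) ((hR _ _).1 (by simpa using hij))
        simp only [hΦ, Equiv.apply_symm_apply] at this
        omega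
      · intro h u v huv
        have := h _ _ ((hR u v).2 huv)
        simp only [hΦ]
        omega
    rw [← cutConnected_iff_finCutConnected e (fun u v => G.Adj u v ∧ Φ f u - Φ f v = 1), ← h1]
    · exact ⟨fun h => h.2, fun h => ⟨h0, h⟩⟩
    · intro u v
      rw [Bool.and_eq_true, hR, beq_iff_eq]
      simp only [hΦ]
      exact and_congr_right fun _ => by omega
  rw [← hinj.injOn.ncard_image]
  congr 1
  ext g
  constructor
  · intro hg
    -- With `n + 1` vertices, labels stay within `n` of the root's 0, so shifting by `n` lands in
    -- `[0, 2n]` and no labeling is lost.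
    have hb : ∀ v, -(n : ℤ) ≤ g v ∧ g v ≤ n := by
      intro v
      have h1 := hG.sub_lt_card hg.2.1 v (e.symm 0)
      have h2 := hG.sub_lt_card hg.2.1 (e.symm 0) v
      rw [hcard, hg.1] at h1 h2
      push_cast at h1 h2
      omega
    have hgΦ : Φ (fun k => ⟨(g (e.symm k.succ) + n).toNat, by
        have := hb (e.symm k.succ)
        omega⟩) = g := by
      funext v
      obtain ⟨i, rfl⟩ := e.symm.surjective v
      simp only [hΦ, Equiv.apply_symm_apply, centeredLabeling]
      refine Fin.cases ?_ (fun k => ?_) i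
      · simp [hg.1]
      · have := hb (e.symm k.succ)
        simp only [Fin.cons_succ]
        omega
    refine ⟨_, ?_, hgΦ⟩
    rw [Finset.mem_coe, Finset.mem_filter, ← hmem, hgΦ]
    exact ⟨Finset.mem_univ _, hg⟩
  · rintro ⟨f, hf, rfl⟩
    rw [Finset.mem_coe, Finset.mem_filter, ← hmem] at hf
    exact hf.2

theorem numFacets_eq_labelingCount {V : Type*} [Fintype V] [DecidableEq V] [Nontrivial V]
    {G : SimpleGraph V} (hG : G.Connected) (e : V ≃ Fin (n + 1))
    (R : Fin (n + 1) → Fin (n + 1) → Bool) (hR : ∀ u v, R (e u) (e v) ↔ G.Adj u v) :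
    numFacets (symmetricEdgePolytope G) = labelingCount R := by
  rw [numFacets_eq_ncard_facetLabelings hG (e.symm 0), ncard_facetLabelings_eq hG e R hR]

end Counting

/-! ### Exhaustive computation on three and four vertices. -/

section SmallGraphs

/-- The adjacency matrix of a graph on three vertices. -/
def adjMatrixThree (a b c : Bool) : Fin 3 → Fin 3 → Bool :=
  ![![false, a, b], ![a, false, c], ![b, c, false]]

/-- The adjacency matrix of a graph on four vertices. -/
def adjMatrixFour (a b c d e f : Bool) : Fin 4 → Fin 4 → Bool :=
  ![![false, a, b, c], ![a, false, d, e], ![b, d, false, f], ![c, e, f, false]]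

theorem eq_adjMatrixThree (R : Fin 3 → Fin 3 → Bool) (hs : ∀ i j, R i j = R j i)
    (hi : ∀ i, R i i = false) : R = adjMatrixThree (R 0 1) (R 0 2) (R 1 2) := by
  funext i j
  fin_cases i <;> fin_cases j <;> first | exact hi _ | rfl | exact hs _ _

theorem eq_adjMatrixFour (R : Fin 4 → Fin 4 → Bool) (hs : ∀ i j, R i j = R j i)
    (hi : ∀ i, R i i = false) :
    R = adjMatrixFour (R 0 1) (R 0 2) (R 0 3) (R 1 2) (R 1 3) (R 2 3) := by
  funext i j
  fin_cases i <;> fin_cases j <;> first | exact hi _ | rfl | exact hs _ _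

/-- The adjacency matrix of the complete bipartite graph on the first `p` and the remaining
vertices. -/
def bipartiteMatrix {n : ℕ} (p : ℕ) (i j : Fin n) : Bool :=
  decide (i.val < p) != decide (j.val < p)

/-- The conjectured bounds on the number of labelings of a graph on `n + 1` vertices, and what is
needed of their cases of equality. -/
def LabelingBounds {n : ℕ} (p lo hi : ℕ) (R : Fin (n + 1) → Fin (n + 1) → Bool) : Prop :=
  lo ≤ labelingCount R ∧ labelingCount R ≤ hi ∧
    (labelingCount R = hi → ∀ i j, i ≠ j → R i j) ∧
    (labelingCount R = lo → ∀ i j, R i j = bipartiteMatrix p i j)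

/-- The path and the triangle. -/
def connectedGraphsThree : List (Fin 3 → Fin 3 → Bool) :=
  [adjMatrixThree true true false, adjMatrixThree true true true]

/-- The star, the path, the cycle, the triangle with a pendant edge, the complete graph without an
edge, and the complete graph. -/
def connectedGraphsFour : List (Fin 4 → Fin 4 → Bool) :=
  [adjMatrixFour true true true false false false, adjMatrixFour true false false true false true,
    adjMatrixFour false true true true true false, adjMatrixFour true true true true false false,
    adjMatrixFour true true true true true false, adjMatrixFour true true true true true true]

theorem exists_perm_connectedGraphsThree : ∀ a b c : Bool,
    FinCutConnected (adjMatrixThree a b c) → ∃ σ : Equiv.Perm (Fin 3),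
      (fun i j => adjMatrixThree a b c (σ i) (σ j)) ∈ connectedGraphsThree := by
  decide +kernel

theorem exists_perm_connectedGraphsFour : ∀ a b c d e f : Bool,
    FinCutConnected (adjMatrixFour a b c d e f) → ∃ σ : Equiv.Perm (Fin 4),
      (fun i j => adjMatrixFour a b c d e f (σ i) (σ j)) ∈ connectedGraphsFour := by
  decide +kernel

theorem map_labelingCount_connectedGraphsThree :
    connectedGraphsThree.map labelingCount = [4, 6] := by
  decide +kernel

theorem map_labelingCount_connectedGraphsFour :
    connectedGraphsFour.map labelingCount = [8, 8, 6, 12, 12, 14] := by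
  decide +kernel

/-- The representatives are numbered so that the minimizer is literally `bipartiteMatrix`, which
turns the equality cases into comparisons of matrices. -/
theorem labelingBounds_three : ∀ R ∈ connectedGraphsThree, LabelingBounds 1 4 6 R := by
  have h := map_labelingCount_connectedGraphsThree
  simp only [connectedGraphsThree, List.map_cons, List.map_nil, List.cons.injEq, and_true] at h
  obtain ⟨h1, h2⟩ := h
  simp only [connectedGraphsThree, List.forall_mem_cons, LabelingBounds, h1, h2,
    List.not_mem_nil, IsEmpty.forall_iff, implies_true, and_true]
  decide

theorem labelingBounds_four : ∀ R ∈ connectedGraphsFour, LabelingBounds 2 6 14 R := by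
  have h := map_labelingCount_connectedGraphsFour
  simp only [connectedGraphsFour, List.map_cons, List.map_nil, List.cons.injEq, and_true] at h
  obtain ⟨h1, h2, h3, h4, h5, h6⟩ := h
  simp only [connectedGraphsFour, List.forall_mem_cons, LabelingBounds, h1, h2, h3, h4, h5, h6,
    List.not_mem_nil, IsEmpty.forall_iff, implies_true, and_true]
  refine ⟨?_, ?_, ?_, ?_, ?_, ?_⟩ <;> decide

theorem labelingCount_bipartiteMatrix_three :
    labelingCount (n := 2) (bipartiteMatrix 1) = 4 := by
  have h : (bipartiteMatrix 1 : Fin 3 → Fin 3 → Bool) = adjMatrixThree true true false := by decide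
  rw [h]
  have h := congrArg (fun l => l[0]?) map_labelingCount_connectedGraphsThree
  exact Option.some.inj h

theorem labelingCount_bipartiteMatrix_four :
    labelingCount (n := 3) (bipartiteMatrix 2) = 6 := by
  have h : (bipartiteMatrix 2 : Fin 4 → Fin 4 → Bool) = adjMatrixFour false true true true true false := by decide
  rw [h]
  have h := congrArg (fun l => l[2]?) map_labelingCount_connectedGraphsFour
  exact Option.some.inj h

theorem labelingCount_complete_three :
    labelingCount (n := 2) (fun i j => decide (i ≠ j)) = 6 := by
  have h : (fun i j => decide (i ≠ j) : Fin 3 → Fin 3 → Bool) = adjMatrixThree true true true := by decide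
  rw [h]
  have h := congrArg (fun l => l[1]?) map_labelingCount_connectedGraphsThree
  exact Option.some.inj h

theorem labelingCount_complete_four :
    labelingCount (n := 3) (fun i j => decide (i ≠ j)) = 14 := by
  have h : (fun i j => decide (i ≠ j) : Fin 4 → Fin 4 → Bool) = adjMatrixFour true true true true true true := by decide
  rw [h]
  have h := congrArg (fun l => l[5]?) map_labelingCount_connectedGraphsFour
  exact Option.some.inj h

end SmallGraphs

/-! ### Degenerate 1-sums with a single summand. -/

section OneSums

variable {V : Type*} {G : SimpleGraph V}

theorem IsOneSum.ne_zero {M : Multiset G.Subgraph} {H : G.Subgraph} (h : IsOneSum M H) :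
    M ≠ 0 := by
  cases h <;> simp

theorem isOneSum_singleton_iff {A H : G.Subgraph} : IsOneSum {A} H ↔ H = A := by
  constructor
  · intro h
    generalize hM : ({A} : Multiset G.Subgraph) = M at h
    cases h with
    | single B => exact (Multiset.singleton_inj.1 hM).symm
    | cons B H M h _ =>
      have := congrArg Multiset.card hM
      rw [Multiset.card_singleton, Multiset.card_cons] at this
      exact absurd (Multiset.card_eq_zero.1 (by omega)) h.ne_zero
  · rintro rfl
    exact IsOneSum.single _

theorem nonempty_iso_top_iff [Fintype V] {m : ℕ} (hm : Fintype.card V = m) :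
    Nonempty (G ≃g (⊤ : SimpleGraph (Fin m))) ↔ G = ⊤ := by
  constructor
  · rintro ⟨φ⟩
    ext u v
    rw [← φ.map_adj_iff, SimpleGraph.top_adj, SimpleGraph.top_adj, φ.injective.ne_iff]
  · rintro rfl
    exact ⟨SimpleGraph.Iso.completeGraph (Fintype.equivFinOfCardEq hm)⟩

theorem nonempty_coe_top_iso_top_iff [Fintype V] {m : ℕ} (hm : Fintype.card V = m) :
    Nonempty ((⊤ : G.Subgraph).coe ≃g (⊤ : SimpleGraph (Fin m))) ↔ G = ⊤ := by
  rw [← nonempty_iso_top_iff hm]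
  exact ⟨fun ⟨φ⟩ => ⟨SimpleGraph.Subgraph.topIso.symm.trans φ⟩,
    fun ⟨φ⟩ => ⟨SimpleGraph.Subgraph.topIso.trans φ⟩⟩

theorem isOneSumOfTriangles_one_iff [Fintype V] (h : Fintype.card V = 3) :
    IsOneSumOfTriangles G 1 ↔ G = ⊤ := by
  rw [← nonempty_coe_top_iso_top_iff h]
  constructor
  · rintro ⟨M, hM, hA, hsum⟩
    obtain ⟨A, rfl⟩ := Multiset.card_eq_one.1 hM
    rw [isOneSum_singleton_iff.1 hsum]
    exact hA A (Multiset.mem_singleton_self A)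
  · intro h
    refine ⟨{⊤}, Multiset.card_singleton _, fun A hA => ?_, IsOneSum.single _⟩
    rwa [Multiset.mem_singleton.1 hA]

theorem isOneSumOfK4WithTriangles_zero_iff [Fintype V] (h : Fintype.card V = 4) :
    IsOneSumOfK4WithTriangles G 0 ↔ G = ⊤ := by
  rw [← nonempty_coe_top_iso_top_iff h]
  constructor
  · rintro ⟨K, M, hM, hK, -, hsum⟩
    rw [Multiset.card_eq_zero] at hM
    subst hM
    rwa [isOneSum_singleton_iff.1 hsum]
  · intro h
    exact ⟨⊤, 0, rfl, h, by simp, IsOneSum.single _⟩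

end OneSums

/-! ### Transfer from adjacency matrices to abstract graphs. -/

section Classification

variable {V : Type*} [Fintype V] [DecidableEq V] {G : SimpleGraph V}

omit [Fintype V] [DecidableEq V] in
theorem nonempty_iso_completeBipartiteGraph_iff (p q : ℕ) :
    Nonempty (G ≃g completeBipartiteGraph (Fin p) (Fin q)) ↔
      ∃ e : V ≃ Fin (p + q), ∀ u v, bipartiteMatrix p (e u) (e v) ↔ G.Adj u v := by
  have key : ∀ x y : Fin p ⊕ Fin q,
      bipartiteMatrix p (finSumFinEquiv x) (finSumFinEquiv y) ↔
        (completeBipartiteGraph (Fin p) (Fin q)).Adj x y := by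
    rintro (x | x) (y | y) <;> simp [bipartiteMatrix]
  constructor
  · rintro ⟨φ⟩
    refine ⟨φ.toEquiv.trans finSumFinEquiv, fun u v => ?_⟩
    exact (key _ _).trans φ.map_adj_iff
  · rintro ⟨e, he⟩
    refine ⟨⟨e.trans finSumFinEquiv.symm, fun {u v} => ?_⟩⟩
    rw [← key, ← he]
    simp

/-- The matrix check gives the bounds and the forward directions of both equality cases. The
converses relabel `G` as the model graph, whose count is `hlo` or `hhi`. -/
theorem bounds_of_labelingBounds [Nontrivial V] (hG : G.Connected) {p q lo hi : ℕ}
    (hcard : Fintype.card V = p + q + 1)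
    (hR : ∀ R : Fin (p + q + 1) → Fin (p + q + 1) → Bool, (∀ i j, R i j = R j i) →
      (∀ i, R i i = false) → FinCutConnected R → ∃ σ : Equiv.Perm (Fin (p + q + 1)),
        LabelingBounds p lo hi fun i j => R (σ i) (σ j))
    (hlo : labelingCount (n := p + q) (bipartiteMatrix p) = lo)
    (hhi : labelingCount (n := p + q) (fun i j => decide (i ≠ j)) = hi) :
    lo ≤ numFacets (symmetricEdgePolytope G) ∧ numFacets (symmetricEdgePolytope G) ≤ hi ∧
      (numFacets (symmetricEdgePolytope G) = lo ↔
        Nonempty (G ≃g completeBipartiteGraph (Fin p) (Fin (q + 1)))) ∧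
      (numFacets (symmetricEdgePolytope G) = hi ↔ G = ⊤) := by
  classical
  let e₀ : V ≃ Fin (p + q + 1) := Fintype.equivFinOfCardEq hcard
  let R₀ : Fin (p + q + 1) → Fin (p + q + 1) → Bool :=
    fun i j => decide (G.Adj (e₀.symm i) (e₀.symm j))
  obtain ⟨σ, h1, h2, h3, h4⟩ := hR R₀ (fun i j => by simp [R₀, G.adj_comm])
    (fun i => by simp [R₀])
    ((cutConnected_iff_finCutConnected e₀ G.Adj R₀ fun u v => by simp [R₀]).1 hG.cutConnected)
  let e : V ≃ Fin (p + q + 1) := e₀.trans σ.symm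
  let R : Fin (p + q + 1) → Fin (p + q + 1) → Bool := fun i j => R₀ (σ i) (σ j)
  have hRG : ∀ u v, R (e u) (e v) ↔ G.Adj u v := fun u v => by simp [R, R₀, e]
  have hcount := numFacets_eq_labelingCount hG e R hRG
  rw [← hcount] at h1 h2 h3 h4
  refine ⟨h1, h2, ⟨fun h => ?_, fun h => ?_⟩, ⟨fun h => ?_, fun h => ?_⟩⟩
  · refine (nonempty_iso_completeBipartiteGraph_iff _ _).2 ⟨e, fun u v => ?_⟩
    rw [← hRG]
    exact Eq.congr_left (h4 h _ _).symm
  · obtain ⟨e', he'⟩ := (nonempty_iso_completeBipartiteGraph_iff _ _).1 h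
    rw [← hlo]
    exact numFacets_eq_labelingCount hG e' _ he'
  · ext u v
    rw [SimpleGraph.top_adj]
    refine ⟨fun h => h.ne, fun huv => (hRG u v).1 (h3 h _ _ (e.injective.ne huv))⟩
  · subst h
    rw [← hhi]
    exact numFacets_eq_labelingCount hG e _ fun u v => by simp

end Classification

theorem proposition2p12 {V : Type*} [Fintype V] [DecidableEq V] (G : SimpleGraph V)
    (hG : G.Connected) (n : ℕ) (hn : Fintype.card V = n) (h34 : n = 3 ∨ n = 4) :
    SatisfiesBraunBruegge G n := by
  have : Nontrivial V := Fintype.one_lt_card_iff_nontrivial.1 (by omega)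
  rcases h34 with rfl | rfl
  · refine ⟨fun _ => ?_, fun h => absurd h (by decide)⟩
    have h := bounds_of_labelingBounds hG (p := 1) (q := 1) hn
      (fun R hs hi hR => by
        rw [eq_adjMatrixThree R hs hi] at hR ⊢
        obtain ⟨σ, hσ⟩ := exists_perm_connectedGraphsThree _ _ _ hR
        exact ⟨σ, labelingBounds_three _ hσ⟩)
      labelingCount_bipartiteMatrix_three labelingCount_complete_three
    rw [← isOneSumOfTriangles_one_iff hn] at h
    exact h
  · refine ⟨fun h => absurd h (by decide), fun _ => ?_⟩
    have h := bounds_of_labelingBounds hG (p := 2) (q := 1) hn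
      (fun R hs hi hR => by
        rw [eq_adjMatrixFour R hs hi] at hR ⊢
        obtain ⟨σ, hσ⟩ := exists_perm_connectedGraphsFour _ _ _ _ _ _ hR
        exact ⟨σ, labelingBounds_four _ hσ⟩)
      labelingCount_bipartiteMatrix_four labelingCount_complete_four
    rw [← isOneSumOfK4WithTriangles_zero_iff hn] at h
    exact h
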